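/- Let $G$ be a bipartite graph with parts $A$, $B$, $|A|=n_1$, $|B|=n_2$. Let $d(X,Y)$ denote the link density (the number of links between $X$ and $Y$ divided by $|X||Y|$, and $0$ if $X$ or $Y$ is empty), and put $L(X,Y)=|X||Y|\,(d(A,B)-d(X,Y))$ for $X\subseteq A$, $Y\subseteq B$. For real $\varepsilon$, $G$ is called $\varepsilon$-regular if $|L(X,Y)|\le\varepsilon n_1n_2$ for all $X\subseteq A$, $Y\subseteq B$. Put $N=2^{n_1+n_2}$ and encode the pairs $(X,Y)$ by bit strings $s\in\{0,1\}^{n_1+n_2}$, one bit per node. Let $f(X,Y)=1$ if $|L(X,Y)|>\varepsilon n_1n_2$ and $f(X,Y)=0$ otherwise. Let $R_f|s\rangle=(-1)^{f(s)}|s\rangle$, $|D\rangle=N^{-1/2}\sum_s|s\rangle$, $R_D=2|D\rangle\langle D|-I$, and let $U=R_DR_f$ be the Grover operator. For an integer $c\ge 0$ let $m=\lceil (n_1+n_2)/2\rceil+c$ and consider the following quantum circuit on a first register of $m$ qubits and a second register of $n_1+n_2$ qubits. Start with $|0\cdots0\rangle$; apply a Hadamard gate to every qubit; for $j=0,\dots,m-1$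 apply $2^j$ times the operator $U$ on the second register, controlled by the qubit of weight $2^j$ of the first register; apply to the first register the standard circuit for the inverse quantum Fourier transform, made of swap, controlled-phase and Hadamard gates; finally measure the first register. Answer "$\varepsilon$-regular" if the measured integer is $0$, and "not $\varepsilon$-regular" otherwise. Then: 1. the last part of the circuit implements the map $|a\rangle\mapsto 2^{-m/2}\sum_{k=0}^{2^m-1}e^{-2\pi i ak/2^m}|k\rangle$ on the first register; 2. the number of applications of the controlled Grover operator is exactly $2^m-1$, and $2^c\sqrt{2^{n_1+n_2}}-1\le 2^m-1\le\sqrt2\,2^c\sqrt{2^{n_1+n_2}}$; 3. the total number of gates, with one controlled Grover operator counted as one gate, is at most $6\cdot2^c\sqrt{2^{n_1+n_2}}$; 4. if $G$ is $\varepsilon$-regular, the answer is "$\varepsilon$-regular" with probability $1$; 5. if $G$ is not $\varepsilon$-regular, the answer is "$\varepsilon$-regular" with probability at most $\min\{3/4,\,4^{-c}\}$. In particular $\varepsilon$-regularity of a bipartite graph with $n_1+n_2$ nodes is decided with one-sided error at most $1/4$ by $O(\sqrt{2^{n_1+n_2}})$ steps of a quantum gate computer. -/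

import Mathlib

noncomputable section

namespace RegularityCheck

/-! ## Regularity of a bipartite graph -/

/-- `L(X, Y) = |X| |Y| (d(A, B) - d(X, Y))`, where `d` is the link density. -/
def deviation {V : Type*} (G : SimpleGraph V) [DecidableRel G.Adj] (A B X Y : Finset V) : ℚ :=
  (X.card : ℚ) * (Y.card : ℚ) * (G.edgeDensity A B - G.edgeDensity X Y)

/-- `G`, with parts `A` and `B`, is `ε`-regular: `|L(X, Y)| ≤ ε |A| |B|` for all `X ⊆ A`, `Y ⊆ B`. -/
def IsRegular {V : Type*} (G : SimpleGraph V) [DecidableRel G.Adj] (A B : Finset V) (ε : ℝ) :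
    Prop :=
  ∀ X ⊆ A, ∀ Y ⊆ B, |(deviation G A B X Y : ℝ)| ≤ ε * (A.card : ℝ) * (B.card : ℝ)

/-- The nodes of `A` whose bit is `1` in the bit string `s`, which has one bit for each node. -/
def selected {V : Type*} (A : Finset V) (s : V → Bool) : Finset V :=
  A.filter fun v => s v = true

open Classical in
/-- The oracle function: `f(X, Y) = 1` iff `|L(X, Y)| > ε |A| |B|`, where the bit string `s`
encodes the pair `(X, Y)`. -/
def oracle {V : Type*} (G : SimpleGraph V) [DecidableRel G.Adj] (A B : Finset V) (ε : ℝ)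
    (s : V → Bool) : Bool :=
  decide (ε * (A.card : ℝ) * (B.card : ℝ) <
    |(deviation G A B (selected A s) (selected B s) : ℝ)|)

/-! ## The Grover operator -/

section Grover

variable {V : Type*} [Fintype V] [DecidableEq V]

/-- The reflection `R_f`: `|s⟩ ↦ -|s⟩` if `f s = 1`, and `|s⟩ ↦ |s⟩` otherwise. -/
def oracleReflection (f : (V → Bool) → Bool) : Matrix (V → Bool) (V → Bool) ℂ :=
  Matrix.diagonal fun s => if f s = true then -1 else 1

/-- The uniform superposition `|D⟩` of the `2 ^ |V|` bit strings. -/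
def uniformState (V : Type*) [Fintype V] : (V → Bool) → ℂ :=
  fun _ => ((1 / √(2 ^ Fintype.card V) : ℝ) : ℂ)

/-- The reflection `R_D = 2 |D⟩⟨D| - I`. -/
def diffusion (V : Type*) [Fintype V] [DecidableEq V] : Matrix (V → Bool) (V → Bool) ℂ :=
  (2 : ℂ) • Matrix.vecMulVec (uniformState V) (star (uniformState V)) - 1

/-- The Grover operator `U = R_D R_f`. -/
def groverOperator (f : (V → Bool) → Bool) : Matrix (V → Bool) (V → Bool) ℂ :=
  diffusion V * oracleReflection f

end Grover

/-! ## Quantum circuits with controlled Grover gates -/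

/-- The qubits: a first register of `m` qubits and a second register with one qubit per node. -/
abbrev Wire (m : ℕ) (V : Type*) : Type _ := Fin m ⊕ V

/-- Computational basis states of the two registers. -/
abbrev BasisState (m : ℕ) (V : Type*) : Type _ := Wire m V → Bool

/-- The elementary steps of the computer. A gate never mentions the graph: the graph
is accessed only through the oracle function that is inside the controlled Grover gate. -/
inductive Gate (m : ℕ) (V : Type*) : Type _
  | /-- Hadamard gate on one qubit -/
    hadamard (q : Wire m V) : Gate m V
  | /-- multiplies by `exp (i φ)` if the two qubits are both `1` -/
    cphase (q r : Wire m V) (φ : ℝ) : Gate m V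
  | /-- exchanges two qubits -/
    swap (q r : Wire m V) : Gate m V
  | /-- Grover operator on the second register, controlled by qubit `j` of the first -/
    cgrover (j : Fin m) : Gate m V

/-- Whether a gate is a controlled Grover gate. -/
def Gate.isCGrover {m : ℕ} {V : Type*} : Gate m V → Bool
  | .cgrover _ => true
  | _ => false

section Semantics

variable {m : ℕ} {V : Type*} [Fintype V] [DecidableEq V]

/-- The unitary matrix of a gate (row = output basis state, column = input basis state), when the
Grover operator is that of `f`. -/
def Gate.toMatrix (f : (V → Bool) → Bool) :
    Gate m V → Matrix (BasisState m V) (BasisState m V) ℂ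
  | .hadamard q => Matrix.of fun x y =>
      if ∀ r, r ≠ q → x r = y r then
        ((1 / √2 : ℝ) : ℂ) * (if x q = true ∧ y q = true then -1 else 1)
      else 0
  | .cphase q r φ => Matrix.diagonal fun x =>
      if x q = true ∧ x r = true then Complex.exp (Complex.I * (φ : ℂ)) else 1
  | .swap q r => Matrix.of fun x y => if x = y ∘ Equiv.swap q r then 1 else 0
  | .cgrover j => Matrix.of fun x y =>
      if x ∘ Sum.inl = y ∘ Sum.inl then
        (if y (Sum.inl j) = true then groverOperator f else 1) (x ∘ Sum.inr) (y ∘ Sum.inr)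
      else 0

/-- The state after running a circuit, a list of gates applied from left to right, on `ψ`. -/
def run (f : (V → Bool) → Bool) : List (Gate m V) → (BasisState m V → ℂ) → (BasisState m V → ℂ)
  | [], ψ => ψ
  | g :: C, ψ => run f C ((g.toMatrix f).mulVec ψ)

/-- The state `|0 ⋯ 0⟩`. -/
def zeroState (m : ℕ) (V : Type*) [Fintype V] : BasisState m V → ℂ :=
  Pi.single (fun _ => false) 1

/-- The integer in the first register; qubit `j` is the bit of weight `2 ^ j`. -/
def readout {m : ℕ} {V : Type*} (x : BasisState m V) : ℕ :=
  ∑ j : Fin m, if x (Sum.inl j) = true then 2 ^ (j : ℕ) else 0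

/-- The probability that a measurement of the first register of `ψ` gives the integer `a`. -/
def measureProb (ψ : BasisState m V → ℂ) (a : ℕ) : ℝ :=
  ∑ x : BasisState m V, if readout x = a then ‖ψ x‖ ^ 2 else 0

/-- The inverse quantum Fourier transform on the first register:
`|a⟩ ↦ 2 ^ (-m / 2) ∑ₖ exp (-2 π i a k / 2 ^ m) |k⟩`. -/
def inverseQFT (m : ℕ) (V : Type*) [Fintype V] : Matrix (BasisState m V) (BasisState m V) ℂ :=
  Matrix.of fun x y =>
    if x ∘ Sum.inr = y ∘ Sum.inr then
      ((1 / √(2 ^ m) : ℝ) : ℂ) * Complex.exp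
        (-(2 * (Real.pi : ℂ) * Complex.I * (readout y : ℂ) * (readout x : ℂ)) / (2 : ℂ) ^ m)
    else 0

end Semantics

/-! ## The phase estimation circuit -/

/-- The standard circuit of the inverse quantum Fourier transform on the first register: a
reversal of the order of the qubits, then controlled phases and Hadamard gates. -/
def inverseQFTCircuit (m : ℕ) (V : Type*) : List (Gate m V) :=
  ((List.finRange m).filter fun i : Fin m => decide (i < i.rev)).map
      (fun i : Fin m => Gate.swap (Sum.inl i) (Sum.inl i.rev)) ++
  (List.finRange m).flatMap fun i : Fin m =>
    ((List.finRange m).filter fun l : Fin m => decide (l < i)).map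
      (fun l : Fin m => Gate.cphase (Sum.inl l) (Sum.inl i)
        (-(2 * Real.pi / 2 ^ ((i : ℕ) - (l : ℕ) + 1)))) ++
    [Gate.hadamard (Sum.inl i)]

/-- Phase estimation with `m` digits for the Grover operator: Hadamard gates on all qubits (which
prepare the uniform superposition in both registers), then for each `j < m` the controlled
Grover gate with control `j`, `2 ^ j` times, then the inverse quantum Fourier transform. -/
def phaseEstimationCircuit (m : ℕ) (V : Type*) [Fintype V] : List (Gate m V) :=
  (List.finRange m).map (fun j : Fin m => Gate.hadamard (Sum.inl j)) ++
  (Finset.univ : Finset V).toList.map (fun v => Gate.hadamard (Sum.inr v)) ++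
  (List.finRange m).flatMap (fun j : Fin m => List.replicate (2 ^ (j : ℕ)) (Gate.cgrover j)) ++
  inverseQFTCircuit m V

/-- The number of controlled Grover gates in a circuit. -/
def groverCount {m : ℕ} {V : Type*} (C : List (Gate m V)) : ℕ :=
  C.countP Gate.isCGrover

/-- The number of binary digits used for `n` nodes: `⌈n / 2⌉ + c`. -/
def digits (n c : ℕ) : ℕ := (n + 1) / 2 + c

/-- The probability that the algorithm answers "`G` is `ε`-regular": phase estimation with `m`
digits is run from `|0 ⋯ 0⟩` and the first register is measured; the answer is "regular" if the
measured phase is `0`, and "not regular" otherwise. -/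
def probAnswerRegular {V : Type*} [Fintype V] [DecidableEq V] (G : SimpleGraph V)
    [DecidableRel G.Adj] (A B : Finset V) (ε : ℝ) (m : ℕ) : ℝ :=
  measureProb (run (oracle G A B ε) (phaseEstimationCircuit m V) (zeroState m V)) 0

end RegularityCheck

end

/-! Let q be the fraction of marked bit strings. Identify the real span of the normalized unmarked
and marked superpositions with ℂ. There |D⟩ is the unit number u = √(1-q) + i√q, and R_f is
conjugation. R_D is the reflection in the line through u, so U is multiplication by w = u²
(`groverOperator_planeVec`).

The row of the inverse Fourier transform at output 0 is constant, so the amplitude of the result 0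
is 2^(-m) (∑ₐ w^a) u. Binary expansion of a turns the sum into ∏ⱼ (1 + w^(2^j)). With pⱼ = |w^(2^j)
- 1|²/4 the probability of the result 0 is thus at most ∏_{j<m} (1 - pⱼ). If nothing is marked, then
w = 1 and the probability is 1.

The pⱼ follow the logistic map p ↦ 4p(1-p) from p₀ = q, which is sin² under angle doubling. So the
product telescopes: 4^m q ∏ (1 - pⱼ) = p_m ≤ 1 (`logistic_prod`). A marked string gives q ≥ 2^(-n),
where n = n₁ + n₂, hence 4^m q ≥ 4^c and the bound 4^(-c). The bound 3/4 comes from a case split on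
whether some pⱼ reaches 1/4. No phase estimate is needed.

That the gate list implements the Fourier transform (`run_inverseQFTCircuit`) is proved by summing
over the input bits stage by stage. -/

noncomputable section

namespace RegularityCheck

/-! ### Action of single gates and of homogeneous gate lists on amplitudes -/

section GateActions

variable {m : ℕ} {V : Type*} [Fintype V] [DecidableEq V]

lemma hadamard_mulVec (f : (V → Bool) → Bool) (q : Wire m V) (ψ : BasisState m V → ℂ)
    (x : BasisState m V) :
    ((Gate.hadamard q).toMatrix f).mulVec ψ x =
      ((1 / √2 : ℝ) : ℂ) * ∑ b : Bool,
        (if x q = true ∧ b = true then -1 else 1) * ψ (Function.update x q b) := by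
  have key : ∀ y : BasisState m V, (∀ r, r ≠ q → x r = y r) ↔ y = Function.update x q (y q) := by
    intro y
    rw [Function.eq_update_iff]
    simp only [true_and]
    exact forall₂_congr fun r _ => eq_comm
  simp only [Matrix.mulVec, dotProduct, Gate.toMatrix, Matrix.of_apply, ite_mul, zero_mul]
  rw [← Finset.sum_filter, Finset.mul_sum]
  symm
  refine Finset.sum_bij (fun b _ => Function.update x q b) ?_ ?_ ?_ ?_
  · intro b _
    simp only [Finset.mem_filter, Finset.mem_univ, true_and]
    intro r hr
    simp [hr]
  · intro b _ b' _ h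
    simpa using congrFun h q
  · intro y hy
    simp only [Finset.mem_filter, Finset.mem_univ, true_and] at hy
    exact ⟨y q, Finset.mem_univ _, ((key y).1 hy).symm⟩
  · intro b _
    simp

lemma cphase_mulVec (f : (V → Bool) → Bool) (q r : Wire m V) (φ : ℝ) (ψ : BasisState m V → ℂ)
    (x : BasisState m V) :
    ((Gate.cphase q r φ).toMatrix f).mulVec ψ x =
      (if x q = true ∧ x r = true then Complex.exp (Complex.I * (φ : ℂ)) else 1) * ψ x := by
  simp [Gate.toMatrix, Matrix.mulVec_diagonal]

lemma swap_mulVec (f : (V → Bool) → Bool) (q r : Wire m V) (ψ : BasisState m V → ℂ)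
    (x : BasisState m V) :
    ((Gate.swap q r).toMatrix f).mulVec ψ x = ψ (x ∘ Equiv.swap q r) := by
  have key : ∀ y : BasisState m V, x = y ∘ Equiv.swap q r ↔ y = x ∘ Equiv.swap q r := by
    intro y
    constructor <;> rintro rfl <;> funext w <;> simp
  simp [Matrix.mulVec, dotProduct, Gate.toMatrix, key]

/-- The sum over the states that agree with `x` on the second register, as a sum over the first
register. -/
lemma sum_ite_second_eq (x : BasisState m V) (F : BasisState m V → ℂ) :
    (∑ y : BasisState m V, if x ∘ Sum.inr = y ∘ Sum.inr then F y else 0) =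
      ∑ a : Fin m → Bool, F (Sum.elim a (x ∘ Sum.inr)) := by
  rw [← (Equiv.sumArrowEquivProdArrow (Fin m) V Bool).symm.sum_comp, Fintype.sum_prod_type]
  refine Finset.sum_congr rfl fun a _ => ?_
  rw [Finset.sum_eq_single (x ∘ Sum.inr)]
  · simp [Equiv.sumArrowEquivProdArrow]
  · intro s _ hs
    simp [Equiv.sumArrowEquivProdArrow, hs.symm]
  · simp

lemma sum_ite_first_eq (x : BasisState m V) (F : BasisState m V → ℂ) :
    (∑ y : BasisState m V, if x ∘ Sum.inl = y ∘ Sum.inl then F y else 0) =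
      ∑ s : V → Bool, F (Sum.elim (x ∘ Sum.inl) s) := by
  rw [← (Equiv.sumArrowEquivProdArrow (Fin m) V Bool).symm.sum_comp, Fintype.sum_prod_type_right]
  refine Finset.sum_congr rfl fun s _ => ?_
  rw [Finset.sum_eq_single (x ∘ Sum.inl)]
  · simp [Equiv.sumArrowEquivProdArrow]
  · intro a _ ha
    simp [Equiv.sumArrowEquivProdArrow, ha.symm]
  · simp

lemma cgrover_mulVec (f : (V → Bool) → Bool) (j : Fin m) (ψ : BasisState m V → ℂ)
    (a : Fin m → Bool) (s : V → Bool) :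
    ((Gate.cgrover j).toMatrix f).mulVec ψ (Sum.elim a s) =
      ((if a j = true then groverOperator f else 1).mulVec fun t => ψ (Sum.elim a t)) s := by
  simp only [Matrix.mulVec, dotProduct, Gate.toMatrix, Matrix.of_apply, ite_mul, zero_mul]
  rw [sum_ite_first_eq]
  rfl

lemma run_append (f : (V → Bool) → Bool) (C C' : List (Gate m V)) (ψ : BasisState m V → ℂ) :
    run f (C ++ C') ψ = run f C' (run f C ψ) := by
  induction C generalizing ψ with
  | nil => rfl
  | cons g C ih => exact ih _

open Classical in
/-- Running a list of Hadamard gates from `|0 ⋯ 0⟩`. -/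
lemma run_hadamards_zeroState (f : (V → Bool) → Bool) (L : List (Wire m V)) (hL : L.Nodup)
    (x : BasisState m V) :
    run f (L.map Gate.hadamard) (zeroState m V) x =
      if ∀ q, q ∉ L → x q = false then ((1 / √2 : ℝ) : ℂ) ^ L.length else 0 := by
  induction L using List.reverseRecOn generalizing x with
  | nil =>
    simp [run, zeroState, Pi.single_apply, funext_iff]
  | append_singleton L q ih =>
    rw [List.nodup_append_comm, List.singleton_append] at hL
    have hq : q ∉ L := by simpa using (List.nodup_cons.1 hL).1
    have hL' : L.Nodup := (List.nodup_cons.1 hL).2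
    rw [List.map_append, run_append]
    simp only [List.map_cons, List.map_nil, run]
    rw [hadamard_mulVec]
    simp only [Fintype.sum_bool, ih hL']
    -- Qubit `q` is still 0 before its own Hadamard gate, so only the branch with bit 0 contributes,
    -- and always with sign +1.
    have h1 : ¬ ∀ r, r ∉ L → Function.update x q true r = false := by
      intro h
      simpa using h q hq
    have h2 : (∀ r, r ∉ L → Function.update x q false r = false) ↔
        ∀ r, r ∉ L ++ [q] → x r = false := by
      constructor
      · intro h r hr
        simp only [List.mem_append, List.mem_singleton, not_or] at hr
        simpa [hr.2] using h r hr.1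
      · intro h r hr
        by_cases hrq : r = q
        · simp [hrq]
        · simpa [hrq] using h r (by simp [hr, hrq])
    simp only [h1, h2, if_false, mul_zero, zero_add]
    simp [pow_succ, mul_comm]

/-- The permutation of the wires that reverses the positions in `L` and their mirror images. -/
def reverseOn (L : List (Fin m)) : Wire m V → Wire m V
  | Sum.inl i => if i ∈ L ∨ i.rev ∈ L then Sum.inl i.rev else Sum.inl i
  | Sum.inr v => Sum.inr v

/-- The condition `i < i.rev` lists each mirror pair only once, so the transpositions are disjoint
and none undoes another. -/
lemma run_swaps (f : (V → Bool) → Bool) (L : List (Fin m)) (hL : L.Nodup)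
    (hlt : ∀ i ∈ L, i < i.rev) (ψ : BasisState m V → ℂ) (x : BasisState m V) :
    run f (L.map fun i => Gate.swap (Sum.inl i) (Sum.inl i.rev)) ψ x = ψ (x ∘ reverseOn L) := by
  induction L generalizing ψ with
  | nil =>
    simp only [List.map_nil, run]
    congr 1
    funext w
    rcases w with i | v <;> simp [reverseOn]
  | cons i L ih =>
    obtain ⟨hi, hL'⟩ := List.nodup_cons.1 hL
    have hlt' : ∀ l ∈ L, l < l.rev := fun l hl => hlt l (List.mem_cons_of_mem _ hl)
    have hi1 : i < i.rev := hlt i List.mem_cons_self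
    have hi2 : i.rev ∉ L := by
      intro h
      have := hlt' _ h
      rw [Fin.rev_rev] at this
      exact absurd this (not_lt.2 hi1.le)
    simp only [List.map_cons, run]
    rw [ih hL' hlt', swap_mulVec]
    congr 1
    funext w
    simp only [Function.comp_apply]
    congr 1
    rcases w with k | v
    · by_cases h1 : k = i
      · subst h1
        simp [reverseOn, hi, hi2]
      · by_cases h2 : k = i.rev
        · subst h2
          simp [reverseOn, hi, hi2]
        · have h3 : k.rev ≠ i := fun h => h2 (by rw [← h, Fin.rev_rev])
          rw [Equiv.swap_apply_of_ne_of_ne (by simpa using h1) (by simpa using h2)]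
          simp [reverseOn, h1, h3]
    · rw [Equiv.swap_apply_of_ne_of_ne (by simp) (by simp)]
      rfl

lemma run_reversal (f : (V → Bool) → Bool) (ψ : BasisState m V → ℂ) (x : BasisState m V) :
    run f (((List.finRange m).filter fun i : Fin m => decide (i < i.rev)).map
      (fun i : Fin m => Gate.swap (Sum.inl i) (Sum.inl i.rev))) ψ x =
      ψ (Sum.elim (fun i => x (Sum.inl i.rev)) (x ∘ Sum.inr)) := by
  rw [run_swaps f _ ((List.nodup_finRange m).filter _) (by simp)]
  congr 1
  funext w
  rcases w with i | v
  · simp only [Function.comp_apply, reverseOn, List.mem_filter, List.mem_finRange, true_and,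
      decide_eq_true_eq, Fin.rev_rev, Sum.elim_inl]
    rcases lt_trichotomy i i.rev with h | h | h
    · simp [h]
    · rw [← h]
      simp
    · simp [h]
  · rfl

lemma run_cphases (f : (V → Bool) → Bool) (i : Fin m) (φ : Fin m → ℝ) (L : List (Fin m))
    (ψ : BasisState m V → ℂ) (x : BasisState m V) :
    run f (L.map fun l => Gate.cphase (Sum.inl l) (Sum.inl i) (φ l)) ψ x =
      (L.map fun l => if x (Sum.inl l) = true ∧ x (Sum.inl i) = true
        then Complex.exp (Complex.I * (φ l : ℂ)) else 1).prod * ψ x := by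
  induction L generalizing ψ with
  | nil => simp [run]
  | cons l L ih =>
    simp only [List.map_cons, run, List.prod_cons]
    rw [ih, cphase_mulVec]
    ring

/-- The phase in the inverse Fourier transform of the output bits `k l`, `l ≤ i`, and an input
bit of weight `2 ^ (m - 1 - i)`. -/
def stagePhase (k : Fin m → Bool) (i : Fin m) : ℂ :=
  ∏ l : Fin m, if l ≤ i ∧ k l = true
    then Complex.exp (Complex.I * ((-(2 * Real.pi / 2 ^ ((i : ℕ) - (l : ℕ) + 1)) : ℝ) : ℂ)) else 1

lemma stagePhase_congr {k k' : Fin m → Bool} {i : Fin m} (h : ∀ l ≤ i, k l = k' l) :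
    stagePhase k i = stagePhase k' i := by
  refine Finset.prod_congr rfl fun l _ => ?_
  by_cases hl : l ≤ i
  · simp [hl, h l hl]
  · simp [hl]

/-- One stage of the inverse Fourier transform circuit. -/
def stage (V : Type*) (i : Fin m) : List (Gate m V) :=
  ((List.finRange m).filter fun l : Fin m => decide (l < i)).map
      (fun l : Fin m => Gate.cphase (Sum.inl l) (Sum.inl i)
        (-(2 * Real.pi / 2 ^ ((i : ℕ) - (l : ℕ) + 1)))) ++
    [Gate.hadamard (Sum.inl i)]

lemma exp_neg_pi_div_one : Complex.exp (Complex.I * ((-(2 * Real.pi / 2 ^ 1) : ℝ) : ℂ)) = -1 := by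
  have : Complex.I * ((-(2 * Real.pi / 2 ^ 1) : ℝ) : ℂ) = -(Real.pi * Complex.I) := by
    push_cast
    ring
  rw [this, Complex.exp_neg, Complex.exp_pi_mul_I]
  norm_num

/-- The factor `l = i` has angle -π: it is the sign of the Hadamard gate, while the factors with `l
< i` are the controlled phases. -/
lemma stagePhase_eq (k : Fin m → Bool) (i : Fin m) :
    stagePhase k i = (if k i = true then -1 else 1) *
      ∏ l : Fin m, if l < i ∧ k l = true
        then Complex.exp (Complex.I * ((-(2 * Real.pi / 2 ^ ((i : ℕ) - (l : ℕ) + 1)) : ℝ) : ℂ))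
        else 1 := by
  have h : (if k i = true then (-1 : ℂ) else 1) =
      ∏ l : Fin m, if l = i then (if k i = true then (-1 : ℂ) else 1) else 1 := by simp
  rw [h, ← Finset.prod_mul_distrib]
  refine Finset.prod_congr rfl fun l _ => ?_
  rcases lt_trichotomy l i with hl | hl | hl
  · simp [hl, hl.le, hl.ne]
  · subst hl
    have := exp_neg_pi_div_one
    simp only [le_refl, true_and, Nat.sub_self, zero_add, lt_irrefl, false_and, if_true, if_false,
      mul_one, this]
  · simp [hl.not_ge, hl.not_gt, hl.ne']

lemma run_stage (f : (V → Bool) → Bool) (i : Fin m) (ψ : BasisState m V → ℂ)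
    (x : BasisState m V) :
    run f (stage V i) ψ x = ((1 / √2 : ℝ) : ℂ) * ∑ b : Bool,
      (if b = true then stagePhase (x ∘ Sum.inl) i else 1) *
        ψ (Function.update x (Sum.inl i) b) := by
  rw [stage, run_append]
  simp only [run]
  rw [hadamard_mulVec]
  congr 1
  refine Finset.sum_congr rfl fun b _ => ?_
  rw [run_cphases f i (fun l => -(2 * Real.pi / 2 ^ ((i : ℕ) - (l : ℕ) + 1))), ← mul_assoc]
  congr 1
  cases b with
  | false => simp
  | true =>
    rw [if_pos rfl, stagePhase_eq]
    simp only [and_true, Function.comp_apply, Function.update_self]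
    congr 1
    rw [← List.prod_toFinset _ ((List.nodup_finRange m).filter _), List.toFinset_filter,
      List.toFinset_finRange, Finset.prod_filter]
    refine Finset.prod_congr rfl fun l _ => ?_
    by_cases hl : l < i
    · simp [hl, hl.ne]
    · simp [hl]

end GateActions

/-! ### The circuit of the inverse quantum Fourier transform -/

section InverseFourier

variable {m : ℕ} {V : Type*} [Fintype V] [DecidableEq V]

open Classical in
lemma run_stages (f : (V → Bool) → Bool) (L : List (Fin m)) (hL : L.Pairwise (· < ·))
    (ψ : BasisState m V → ℂ) (x : BasisState m V) :
    run f (L.flatMap (stage V)) ψ x = ((1 / √2 : ℝ) : ℂ) ^ L.length *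
      ∑ a : Fin m → Bool, if ∀ i, i ∉ L → a i = x (Sum.inl i) then
        (∏ i ∈ L.toFinset, if a i = true then stagePhase (x ∘ Sum.inl) i else 1) *
          ψ (Sum.elim a (x ∘ Sum.inr)) else 0 := by
  induction L using List.reverseRecOn generalizing x with
  | nil =>
    have hx : ∀ a : Fin m → Bool, (∀ i, a i = x (Sum.inl i)) ↔ a = x ∘ Sum.inl := fun a =>
      funext_iff.symm
    simp [run, hx]
  | append_singleton L p ih =>
    obtain ⟨hL', -, hLp⟩ := List.pairwise_append.1 hL
    have hlt : ∀ i ∈ L, i < p := fun i hi => hLp i hi p (by simp)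
    have hp : p ∉ L := fun h => lt_irrefl _ (hlt p h)
    rw [List.flatMap_append, run_append, List.flatMap_singleton, run_stage]
    simp only [ih hL', List.length_append, List.length_singleton, pow_succ']
    rw [mul_assoc]
    congr 1
    simp only [mul_left_comm _ (((1 / √2 : ℝ) : ℂ) ^ L.length)]
    rw [← Finset.mul_sum]
    congr 1
    simp only [Finset.mul_sum]
    rw [Finset.sum_comm]
    refine Finset.sum_congr rfl fun a _ => ?_
    -- Stage `p` sums over the old bit `b` of wire `p`. The earlier stages do not touch that wire,
    -- so only `b = a p` survives.
    rw [Finset.sum_eq_single (a p)]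
    · have h1 : (∀ i, i ∉ L → a i = Function.update x (Sum.inl p) (a p) (Sum.inl i)) ↔
          ∀ i, i ∉ L ++ [p] → a i = x (Sum.inl i) := by
        constructor
        · intro h i hi
          simp only [List.mem_append, List.mem_singleton, not_or] at hi
          simpa [hi.2] using h i hi.1
        · intro h i hi
          by_cases hip : i = p
          · simp [hip]
          · simpa [hip] using h i (by simp [hi, hip])
      -- The increasing order of the stages enters here: an earlier stage reads only bits up to `i <
      -- p`, which are already output bits.
      have h2 : ∀ i ∈ L.toFinset,
          stagePhase (Function.update x (Sum.inl p) (a p) ∘ Sum.inl) i =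
            stagePhase (x ∘ Sum.inl) i := by
        intro i hi
        refine stagePhase_congr fun l hl => ?_
        have : l ≠ p := (hl.trans_lt (hlt i (List.mem_toFinset.1 hi))).ne
        simp [this]
      have h3 : Function.update x (Sum.inl p) (a p) ∘ Sum.inr = x ∘ Sum.inr := by
        funext v
        simp
      have h4 : (L ++ [p]).toFinset = insert p L.toFinset := by
        ext i
        simp
      have h5 : (∏ i ∈ L.toFinset, if a i = true then
          stagePhase (Function.update x (Sum.inl p) (a p) ∘ Sum.inl) i else 1) =
            ∏ i ∈ L.toFinset, if a i = true then stagePhase (x ∘ Sum.inl) i else 1 :=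
        Finset.prod_congr rfl fun i hi => by rw [h2 i hi]
      simp only [h1, h3, h4, h5, Finset.prod_insert fun h => hp (List.mem_toFinset.1 h)]
      rw [mul_ite, mul_zero, mul_assoc]
    · intro b _ hb
      refine mul_eq_zero_of_right _ (if_neg fun h => ?_)
      have := h p hp
      simp only [Function.update_self] at this
      exact hb this.symm
    · simp

/-- The integer with binary digits `a`. -/
def bitsValue (a : Fin m → Bool) : ℕ := ∑ j : Fin m, if a j = true then 2 ^ (j : ℕ) else 0

lemma exp_two_pi_mul_nat (z : ℂ) (n : ℕ) :
    Complex.exp (z - n * (2 * Real.pi * Complex.I)) = Complex.exp z := by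
  rw [Complex.exp_sub, Complex.exp_nat_mul_two_pi_mul_I, div_one]

/-- Expand the product of the two integers into pairs of bits of weights 2^j and 2^l. Pairs with j +
l ≥ m contribute full turns; the others are the phases of the circuit. -/
lemma prod_stagePhase (a k : Fin m → Bool) :
    (∏ i : Fin m, if a i.rev = true then stagePhase k i else 1) =
      Complex.exp (-(2 * (Real.pi : ℂ) * Complex.I * (bitsValue a : ℂ) * (bitsValue k : ℂ)) /
        (2 : ℂ) ^ m) := by
  rw [← Equiv.prod_comp Fin.revPerm]
  simp only [Fin.revPerm_apply, Fin.rev_rev]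
  have h : -(2 * (Real.pi : ℂ) * Complex.I * (bitsValue a : ℂ) * (bitsValue k : ℂ)) / (2 : ℂ) ^ m =
      ∑ j : Fin m, ∑ l : Fin m, if a j = true ∧ k l = true
        then -(2 * (Real.pi : ℂ) * Complex.I) * 2 ^ (j : ℕ) * 2 ^ (l : ℕ) / 2 ^ m else 0 := by
    have e : ∀ b : Fin m → Bool, ((bitsValue b : ℕ) : ℂ) =
        ∑ j : Fin m, if b j = true then (2 : ℂ) ^ (j : ℕ) else 0 := by
      intro b
      rw [bitsValue]
      push_cast
      rfl
    rw [e, e, ← neg_mul, ← neg_mul, mul_assoc, Finset.sum_mul_sum, Finset.mul_sum, Finset.sum_div]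
    refine Finset.sum_congr rfl fun j _ => ?_
    rw [Finset.mul_sum, Finset.sum_div]
    refine Finset.sum_congr rfl fun l _ => ?_
    by_cases h1 : a j = true <;> by_cases h2 : k l = true <;> simp [h1, h2]; ring
  rw [h, Complex.exp_sum]
  refine Finset.prod_congr rfl fun j _ => ?_
  by_cases h1 : a j = true
  · rw [if_pos h1, Complex.exp_sum, stagePhase]
    refine Finset.prod_congr rfl fun l _ => ?_
    by_cases h2 : k l = true
    · simp only [h1, h2, and_true, if_true]
      have hj := j.isLt
      have hl := l.isLt
      have hrev : ((j.rev : Fin m) : ℕ) = m - 1 - j := by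
        rw [Fin.val_rev]
        omega
      by_cases hlj : l ≤ j.rev
      · rw [if_pos hlj]
        congr 1
        have h3 : (l : ℕ) ≤ m - 1 - j := hrev ▸ hlj
        have h4 : m = (((j.rev : Fin m) : ℕ) - (l : ℕ) + 1) + j + l := by omega
        have h5 : (2 : ℂ) ^ m = 2 ^ (((j.rev : Fin m) : ℕ) - (l : ℕ) + 1) * 2 ^ (j : ℕ) *
            2 ^ (l : ℕ) := by
          rw [← pow_add, ← pow_add, ← h4]
        rw [h5]
        push_cast
        field_simp
      · rw [if_neg hlj]
        have h3 : m - 1 - j < (l : ℕ) := hrev ▸ not_le.1 hlj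
        -- Here 2^(j+l) / 2^m = 2^d is an integer, so the phase is trivial.
        obtain ⟨d, hd⟩ : ∃ d, (j : ℕ) + l = m + d := ⟨j + l - m, by omega⟩
        have := exp_two_pi_mul_nat 0 (2 ^ d)
        rw [Complex.exp_zero] at this
        rw [← this]
        congr 1
        rw [mul_assoc _ ((2 : ℂ) ^ (j : ℕ)), ← pow_add, hd, pow_add]
        push_cast
        field_simp
        ring
    · simp [h2]
  · simp [h1]

lemma ofReal_one_div_sqrt_two_pow (n : ℕ) :
    ((1 / √2 : ℝ) : ℂ) ^ n = ((1 / √(2 ^ n) : ℝ) : ℂ) := by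
  rw [← Complex.ofReal_pow, one_div_pow, Real.sqrt_eq_rpow, Real.sqrt_eq_rpow, ← Real.rpow_natCast,
    ← Real.rpow_mul (by norm_num), mul_comm, Real.rpow_mul (by norm_num), Real.rpow_natCast]

theorem run_inverseQFTCircuit (f : (V → Bool) → Bool) (ψ : BasisState m V → ℂ) :
    run f (inverseQFTCircuit m V) ψ = (inverseQFT m V).mulVec ψ := by
  funext x
  have hC : inverseQFTCircuit m V =
      ((List.finRange m).filter fun i : Fin m => decide (i < i.rev)).map
        (fun i : Fin m => Gate.swap (Sum.inl i) (Sum.inl i.rev)) ++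
      (List.finRange m).flatMap (stage V) := rfl
  rw [hC, run_append, run_stages f _ (List.pairwise_lt_finRange m)]
  simp only [run_reversal, List.mem_finRange, not_true_eq_false, false_imp_iff, implies_true,
    if_true, List.length_finRange, List.toFinset_finRange, Sum.elim_inl, Sum.elim_comp_inr]
  simp only [Matrix.mulVec, dotProduct, inverseQFT, Matrix.of_apply, ite_mul, zero_mul]
  rw [sum_ite_second_eq, Finset.mul_sum]
  -- Reindexing by bit reversal absorbs the swaps at the start of the circuit.
  let e : (Fin m → Bool) ≃ (Fin m → Bool) := Fin.revPerm.arrowCongr (Equiv.refl Bool)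
  rw [← e.sum_comp]
  refine Finset.sum_congr rfl fun a _ => ?_
  have h1 : ∀ i, e a i = a i.rev := fun i => rfl
  have h2 := prod_stagePhase a (x ∘ Sum.inl)
  simp only [h1, Fin.rev_rev]
  rw [h2, ofReal_one_div_sqrt_two_pow, ← mul_assoc]
  rfl

end InverseFourier

/-! ### The Grover operator as a rotation of a plane -/

section GroverPlane

variable {V : Type*} [Fintype V] [DecidableEq V]

/-- The fraction of marked bit strings. -/
def markedFraction (f : (V → Bool) → Bool) : ℝ :=
  ((Finset.univ.filter fun s => f s = true).card : ℝ) / 2 ^ Fintype.card V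

lemma markedFraction_nonneg (f : (V → Bool) → Bool) : 0 ≤ markedFraction f := by
  unfold markedFraction
  positivity

lemma card_marked (f : (V → Bool) → Bool) :
    ((Finset.univ.filter fun s => f s = true).card : ℝ) =
      2 ^ Fintype.card V * markedFraction f := by
  unfold markedFraction
  field_simp

lemma card_unmarked (f : (V → Bool) → Bool) :
    ((Finset.univ.filter fun s => ¬ f s = true).card : ℝ) =
      2 ^ Fintype.card V * (1 - markedFraction f) := by
  have h := Finset.card_filter_add_card_filter_not (s := (Finset.univ : Finset (V → Bool)))
    (fun s => f s = true)
  rw [Finset.card_univ, Fintype.card_fun, Fintype.card_bool] at h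
  have h' : ((Finset.univ.filter fun s => f s = true).card : ℝ) +
      ((Finset.univ.filter fun s => ¬ f s = true).card : ℝ) = 2 ^ Fintype.card V := by
    exact_mod_cast h
  rw [card_marked] at h'
  linarith

lemma markedFraction_le_one (f : (V → Bool) → Bool) : markedFraction f ≤ 1 := by
  have h := card_unmarked f
  have h0 : (0 : ℝ) ≤ 2 ^ Fintype.card V * (1 - markedFraction f) := h ▸ Nat.cast_nonneg _
  have := nonneg_of_mul_nonneg_right h0 (by positivity)
  linarith

lemma inv_le_markedFraction {f : (V → Bool) → Bool} {s : V → Bool} (hs : f s = true) :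
    1 / 2 ^ Fintype.card V ≤ markedFraction f := by
  unfold markedFraction
  gcongr
  exact_mod_cast Finset.card_pos.2 ⟨s, by simpa using hs⟩

lemma markedFraction_pos {f : (V → Bool) → Bool} {s : V → Bool} (hs : f s = true) :
    0 < markedFraction f :=
  lt_of_lt_of_le (by positivity) (inv_le_markedFraction hs)

lemma markedFraction_lt_one {f : (V → Bool) → Bool} {s : V → Bool} (hs : ¬ f s = true) :
    markedFraction f < 1 := by
  have h : (0 : ℝ) < 2 ^ Fintype.card V * (1 - markedFraction f) := by
    rw [← card_unmarked]
    exact_mod_cast Finset.card_pos.2 ⟨s, by simpa using hs⟩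
  have := pos_of_mul_pos_right h (by positivity)
  linarith

/-- The coordinates of the uniform superposition in the Grover plane. -/
def startPoint (f : (V → Bool) → Bool) : ℂ :=
  ⟨√(1 - markedFraction f), √(markedFraction f)⟩

/-- The vector of the Grover plane with coordinates `z`; the real axis corresponds to the unmarked
bit strings and the imaginary axis to the marked ones. -/
def planeVec (f : (V → Bool) → Bool) (z : ℂ) : (V → Bool) → ℂ := fun s =>
  ((if f s = true then z.im / √(markedFraction f) else z.re / √(1 - markedFraction f) : ℝ) : ℂ)

lemma planeVec_sum {ι : Type*} (f : (V → Bool) → Bool) (S : Finset ι) (z : ι → ℂ)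
    (s : V → Bool) : planeVec f (∑ i ∈ S, z i) s = ∑ i ∈ S, planeVec f (z i) s := by
  unfold planeVec
  by_cases h : f s = true
  · simp [h, Finset.sum_div]
  · simp [h, Finset.sum_div]

/-- `planeVec` is scaled so that `startPoint` goes to the all-ones vector. A square root is divided
by only where a string of its class exists, so q = 0 and q = 1 need no exception. -/
lemma uniformState_eq (f : (V → Bool) → Bool) :
    uniformState V = ((1 / √(2 ^ Fintype.card V) : ℝ) : ℂ) • planeVec f (startPoint f) := by
  funext s
  have h : planeVec f (startPoint f) s = 1 := by
    unfold planeVec startPoint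
    by_cases h : f s = true
    · have := Real.sqrt_pos.2 (markedFraction_pos h)
      simp [h, this.ne']
    · have := Real.sqrt_pos.2 (sub_pos.2 (markedFraction_lt_one h))
      simp [h, this.ne']
  simp [uniformState, h]

lemma sum_marked_unmarked (f : (V → Bool) → Bool) (a b : ℝ) :
    (∑ s : V → Bool, if f s = true then a else b) =
      2 ^ Fintype.card V * (markedFraction f * a + (1 - markedFraction f) * b) := by
  rw [Finset.sum_ite, Finset.sum_const, Finset.sum_const, nsmul_eq_mul, nsmul_eq_mul, card_marked,
    card_unmarked]
  ring

lemma groverOperator_mulVec (f : (V → Bool) → Bool) (v : (V → Bool) → ℂ) (s : V → Bool) :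
    (groverOperator f).mulVec v s =
      2 / 2 ^ Fintype.card V * (∑ t, (if f t = true then -1 else 1) * v t) -
        (if f s = true then -1 else 1) * v s := by
  have hD : ((1 / √(2 ^ Fintype.card V) : ℝ) : ℂ) * ((1 / √(2 ^ Fintype.card V) : ℝ) : ℂ) =
      1 / 2 ^ Fintype.card V := by
    rw [← Complex.ofReal_mul, div_mul_div_comm, Real.mul_self_sqrt (by positivity)]
    push_cast
    ring
  rw [groverOperator, ← Matrix.mulVec_mulVec, diffusion, Matrix.sub_mulVec, Matrix.one_mulVec,
    Pi.sub_apply, oracleReflection, Matrix.mulVec_diagonal]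
  congr 1
  simp only [Matrix.mulVec, dotProduct, Matrix.smul_apply, Matrix.vecMulVec_apply, uniformState,
    Pi.star_apply, RCLike.star_def, Complex.conj_ofReal, hD, smul_eq_mul, Finset.mul_sum,
    Matrix.diagonal_apply, ite_mul, zero_mul, Finset.sum_ite_eq, Finset.mem_univ, if_true]
  refine Finset.sum_congr rfl fun t _ => ?_
  ring

/-- The Grover operator acts on the Grover plane as a rotation. -/
lemma groverOperator_planeVec (f : (V → Bool) → Bool) (z : ℂ) :
    (groverOperator f).mulVec (planeVec f z) = planeVec f (startPoint f ^ 2 * z) := by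
  funext s
  have hq := Real.sq_sqrt (markedFraction_nonneg f)
  have hq' := Real.sq_sqrt (sub_nonneg.2 (markedFraction_le_one f))
  have hsum : (∑ t, (if f t = true then (-1 : ℂ) else 1) * planeVec f z t) =
      ((2 ^ Fintype.card V *
        (√(1 - markedFraction f) * z.re - √(markedFraction f) * z.im) : ℝ) : ℂ) := by
    have h1 : ∀ t, (if f t = true then (-1 : ℂ) else 1) * planeVec f z t =
        ((if f t = true then -(z.im / √(markedFraction f))
          else z.re / √(1 - markedFraction f) : ℝ) : ℂ) := by
      intro t
      by_cases h : f t = true <;> simp [planeVec, h]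
    -- This survives q = 0, where division by zero makes both sides vanish; `h3` does the same for q
    -- = 1.
    have h2 : markedFraction f * -(z.im / √(markedFraction f)) =
        -(√(markedFraction f) * z.im) := by
      by_cases h : √(markedFraction f) = 0
      · rw [h] at hq ⊢
        simp
      · nth_rw 1 [← hq]
        field_simp
    have h3 : (1 - markedFraction f) * (z.re / √(1 - markedFraction f)) =
        √(1 - markedFraction f) * z.re := by
      by_cases h : √(1 - markedFraction f) = 0
      · rw [h] at hq' ⊢
        simp
      · nth_rw 1 [← hq']
        field_simp
    simp only [h1]
    rw [← Complex.ofReal_sum, sum_marked_unmarked, h2, h3]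
    congr 1
    ring
  rw [groverOperator_mulVec, hsum]
  have hN : (2 : ℂ) ^ Fintype.card V ≠ 0 := pow_ne_zero _ two_ne_zero
  have hre : (startPoint f ^ 2 * z).re = (1 - 2 * markedFraction f) * z.re -
      2 * √(markedFraction f) * √(1 - markedFraction f) * z.im := by
    simp only [startPoint, pow_two, Complex.mul_re, Complex.mul_im]
    linear_combination z.re * hq' - z.re * hq
  have him : (startPoint f ^ 2 * z).im = (1 - 2 * markedFraction f) * z.im +
      2 * √(markedFraction f) * √(1 - markedFraction f) * z.re := by
    simp only [startPoint, pow_two, Complex.mul_re, Complex.mul_im]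
    linear_combination z.im * hq' - z.im * hq
  by_cases h : f s = true
  · have h0 := (Real.sqrt_pos.2 (markedFraction_pos h)).ne'
    simp only [planeVec, h, if_true, him]
    have : ((1 - 2 * markedFraction f) * z.im +
        2 * √(markedFraction f) * √(1 - markedFraction f) * z.re) / √(markedFraction f) =
        2 * (√(1 - markedFraction f) * z.re - √(markedFraction f) * z.im) +
          z.im / √(markedFraction f) := by
      field_simp
      linear_combination (2 * z.im) * hq
    rw [this]
    push_cast
    field_simp
    ring
  · have h0 := (Real.sqrt_pos.2 (sub_pos.2 (markedFraction_lt_one h))).ne'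
    simp only [planeVec, h, hre]
    have : ((1 - 2 * markedFraction f) * z.re -
        2 * √(markedFraction f) * √(1 - markedFraction f) * z.im) / √(1 - markedFraction f) =
        2 * (√(1 - markedFraction f) * z.re - √(markedFraction f) * z.im) -
          z.re / √(1 - markedFraction f) := by
      field_simp
      linear_combination (-2 * z.re) * hq'
    simp only [if_false, Bool.false_eq_true, this]
    push_cast
    field_simp

lemma groverOperator_pow_planeVec (f : (V → Bool) → Bool) (k : ℕ) (z : ℂ) :
    (groverOperator f ^ k).mulVec (planeVec f z) = planeVec f ((startPoint f ^ 2) ^ k * z) := by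
  induction k with
  | zero => simp
  | succ k ih =>
    rw [pow_succ', ← Matrix.mulVec_mulVec, ih, groverOperator_planeVec, pow_succ' _ k, mul_assoc]

/-- Equality can fail only for q = 0 or q = 1, when the coordinate of the empty class is lost. An
upper bound is enough for the error estimate. -/
lemma sum_norm_planeVec_le (f : (V → Bool) → Bool) (z : ℂ) :
    ∑ s, ‖planeVec f z s‖ ^ 2 ≤ 2 ^ Fintype.card V * ‖z‖ ^ 2 := by
  have h1 : ∀ s, ‖planeVec f z s‖ ^ 2 = if f s = true then (z.im / √(markedFraction f)) ^ 2
      else (z.re / √(1 - markedFraction f)) ^ 2 := by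
    intro s
    rw [planeVec, Complex.norm_real, Real.norm_eq_abs, sq_abs]
    split_ifs <;> rfl
  have h2 : ∀ q a : ℝ, 0 ≤ q → q * (a / √q) ^ 2 ≤ a ^ 2 := by
    intro q a hq
    rw [div_pow, Real.sq_sqrt hq]
    rcases hq.eq_or_lt with rfl | hq
    · simpa using sq_nonneg a
    · exact (mul_div_cancel₀ _ hq.ne').le
  simp only [h1]
  rw [sum_marked_unmarked, Complex.sq_norm, Complex.normSq_apply]
  refine mul_le_mul_of_nonneg_left ?_ (by positivity)
  have := h2 _ z.im (markedFraction_nonneg f)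
  have := h2 _ z.re (sub_nonneg.2 (markedFraction_le_one f))
  linarith

lemma norm_startPoint (f : (V → Bool) → Bool) : ‖startPoint f‖ = 1 := by
  have hq := Real.mul_self_sqrt (markedFraction_nonneg f)
  have hq' := Real.mul_self_sqrt (sub_nonneg.2 (markedFraction_le_one f))
  rw [← sq_eq_sq₀ (norm_nonneg _) zero_le_one, Complex.sq_norm, Complex.normSq_apply]
  simp only [startPoint]
  rw [hq, hq']
  ring

/-- If q = sin² θ, then w = e^(2iθ) and |w - 1| = 2 sin θ. -/
lemma norm_startPoint_sq_sub_one (f : (V → Bool) → Bool) :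
    ‖startPoint f ^ 2 - 1‖ ^ 2 = 4 * markedFraction f := by
  have hq := Real.sq_sqrt (markedFraction_nonneg f)
  have hq' := Real.sq_sqrt (sub_nonneg.2 (markedFraction_le_one f))
  have hre : (startPoint f ^ 2 - 1).re = - 2 * markedFraction f := by
    simp only [startPoint, pow_two, Complex.mul_re, Complex.sub_re, Complex.one_re]
    linear_combination hq' - hq
  have him : (startPoint f ^ 2 - 1).im = 2 * √(markedFraction f) * √(1 - markedFraction f) := by
    simp only [startPoint, pow_two, Complex.mul_im, Complex.sub_im, Complex.one_im]
    ring
  rw [Complex.sq_norm, Complex.normSq_apply, hre, him]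
  linear_combination (4 * √(1 - markedFraction f) ^ 2) * hq + 4 * markedFraction f * hq'

end GroverPlane

/-! ### Products along orbits of the logistic map -/

section Bounds

/-- Parallelogram law for the unit numbers 1 and `w`. -/
lemma norm_add_one_sq {w : ℂ} (hw : ‖w‖ = 1) : ‖1 + w‖ ^ 2 = 4 - ‖w - 1‖ ^ 2 := by
  have h : Complex.normSq w = 1 := by rw [← Complex.sq_norm, hw, one_pow]
  rw [Complex.normSq_apply] at h
  rw [Complex.sq_norm, Complex.sq_norm, Complex.normSq_apply, Complex.normSq_apply]
  simp only [Complex.add_re, Complex.add_im, Complex.sub_re, Complex.sub_im, Complex.one_re,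
    Complex.one_im]
  linear_combination 2 * h

/-- Each 1 - pⱼ is p_{j+1} / (4 pⱼ), so the product telescopes; the form without division also
covers orbits that hit 0. -/
lemma logistic_prod {p : ℕ → ℝ} (hp : ∀ j, p (j + 1) = 4 * p j * (1 - p j)) (m : ℕ) :
    4 ^ m * p 0 * ∏ j ∈ Finset.range m, (1 - p j) = p m := by
  induction m with
  | zero => simp
  | succ m ih =>
    rw [Finset.prod_range_succ, hp, ← ih]
    ring

lemma logistic_prod_le_inv {p : ℕ → ℝ} (hp : ∀ j, p (j + 1) = 4 * p j * (1 - p j))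
    (h1 : ∀ j, p j ≤ 1) {m c : ℕ} (hc : 4 ^ c ≤ 4 ^ m * p 0) :
    ∏ j ∈ Finset.range m, (1 - p j) ≤ (1 / 4) ^ c := by
  have h := logistic_prod hp m
  have h0 : 0 ≤ ∏ j ∈ Finset.range m, (1 - p j) :=
    Finset.prod_nonneg fun j _ => sub_nonneg.2 (h1 j)
  rw [one_div_pow, le_div_iff₀ (by positivity), mul_comm]
  calc _ ≤ 4 ^ m * p 0 * ∏ j ∈ Finset.range m, (1 - p j) := by gcongr
    _ = p m := h
    _ ≤ 1 := h1 m

/-- If some pⱼ ≥ 1/4, that one factor is at most 3/4. Otherwise p_{m-1} < 1/4, and the telescoped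
product is at most p_m = 4 p_{m-1} (1 - p_{m-1}) ≤ 3/4. The index m - 1 is why `m` must be positive.
-/
lemma logistic_prod_le_three_quarters {p : ℕ → ℝ}
    (hp : ∀ j, p (j + 1) = 4 * p j * (1 - p j)) (h0 : ∀ j, 0 ≤ p j) (h1 : ∀ j, p j ≤ 1) {m : ℕ}
    (hm : 0 < m) (hc : 1 ≤ 4 ^ m * p 0) :
    ∏ j ∈ Finset.range m, (1 - p j) ≤ 3 / 4 := by
  by_cases h : ∃ j ∈ Finset.range m, 1 / 4 ≤ p j
  · obtain ⟨j, hj, hpj⟩ := h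
    rw [← Finset.mul_prod_erase _ _ hj]
    have h2 : ∏ i ∈ (Finset.range m).erase j, (1 - p i) ≤ 1 :=
      Finset.prod_le_one (fun i _ => sub_nonneg.2 (h1 i)) fun i _ => by linarith [h0 i]
    have h3 : 0 ≤ 1 - p j := sub_nonneg.2 (h1 j)
    nlinarith
  · push Not at h
    obtain ⟨k, rfl⟩ : ∃ k, m = k + 1 := ⟨m - 1, by omega⟩
    have h2 := h k (by simp)
    have h3 := logistic_prod hp (k + 1)
    have h4 : 0 ≤ ∏ j ∈ Finset.range (k + 1), (1 - p j) :=
      Finset.prod_nonneg fun j _ => sub_nonneg.2 (h1 j)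
    calc _ ≤ 4 ^ (k + 1) * p 0 * ∏ j ∈ Finset.range (k + 1), (1 - p j) :=
          le_mul_of_one_le_left h4 hc
      _ = 4 * p k * (1 - p k) := by rw [h3, hp]
      _ ≤ 3 / 4 := by nlinarith [h0 k]

end Bounds

/-! ### Amplitudes and probability of the measurement result 0 -/

section Circuit

variable {m : ℕ} {V : Type*} [Fintype V] [DecidableEq V]

/-- The controls are never changed, so each branch `a` of the first register evolves on its own and
collects one Grover factor per gate whose control bit is set. -/
lemma run_cgrovers (f : (V → Bool) → Bool) (J : List (Fin m)) (ψ : BasisState m V → ℂ)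
    (a : Fin m → Bool) (s : V → Bool) :
    run f (J.map Gate.cgrover) ψ (Sum.elim a s) =
      ((groverOperator f ^ J.countP a).mulVec fun t => ψ (Sum.elim a t)) s := by
  induction J generalizing ψ with
  | nil => simp [run]
  | cons j J ih =>
    simp only [List.map_cons, run]
    rw [ih]
    simp only [cgrover_mulVec]
    change Matrix.mulVec _ (Matrix.mulVec _ _) s = _
    rw [Matrix.mulVec_mulVec, List.countP_cons]
    by_cases h : a j = true
    · simp [h, pow_succ]
    · simp [h]

lemma flatMap_cgrover_eq {m : ℕ} {V : Type*} :
    (List.finRange m).flatMap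
      (fun j : Fin m => List.replicate (2 ^ (j : ℕ)) (Gate.cgrover j : Gate m V)) =
    ((List.finRange m).flatMap fun j : Fin m => List.replicate (2 ^ (j : ℕ)) j).map
      Gate.cgrover := by
  rw [List.map_flatMap]
  simp

lemma countP_flatMap_replicate (a : Fin m → Bool) :
    ((List.finRange m).flatMap fun j : Fin m => List.replicate (2 ^ (j : ℕ)) j).countP a =
      bitsValue a := by
  rw [List.countP_flatMap, bitsValue, Fin.sum_univ_def]
  congr 1
  refine List.map_congr_left fun j _ => ?_
  simp [List.countP_replicate]

/-- Expanding the product chooses for each j whether the bit of weight 2^j is set. -/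
lemma sum_pow_bitsValue (w : ℂ) :
    ∑ a : Fin m → Bool, w ^ bitsValue a = ∏ j ∈ Finset.range m, (1 + w ^ 2 ^ j) := by
  have h := Finset.prod_univ_sum (fun _ : Fin m => (Finset.univ : Finset Bool))
    (fun j b => if b = true then w ^ 2 ^ (j : ℕ) else 1)
  rw [Fintype.piFinset_univ] at h
  rw [Finset.prod_range fun j => 1 + w ^ 2 ^ j]
  trans ∏ j : Fin m, ∑ b : Bool, if b = true then w ^ 2 ^ (j : ℕ) else 1
  · rw [h]
    refine Finset.sum_congr rfl fun a _ => ?_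
    rw [bitsValue, ← Finset.prod_pow_eq_pow_sum]
    refine Finset.prod_congr rfl fun j _ => ?_
    by_cases h : a j = true <;> simp [h]
  · simp [add_comm]

lemma run_hadamard_layers (f : (V → Bool) → Bool) (x : BasisState m V) :
    run f ((List.finRange m).map (fun j : Fin m => Gate.hadamard (Sum.inl j)) ++
      (Finset.univ : Finset V).toList.map (fun v => Gate.hadamard (Sum.inr v)))
      (zeroState m V) x =
      ((1 / √(2 ^ m) : ℝ) : ℂ) * ((1 / √(2 ^ Fintype.card V) : ℝ) : ℂ) := by
  classical
  have h : (List.finRange m).map (fun j : Fin m => (Gate.hadamard (Sum.inl j) : Gate m V)) ++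
      (Finset.univ : Finset V).toList.map (fun v => Gate.hadamard (Sum.inr v)) =
      ((List.finRange m).map Sum.inl ++ (Finset.univ : Finset V).toList.map Sum.inr).map
        Gate.hadamard := by
    simp only [List.map_append, List.map_map]
    rfl
  rw [h, run_hadamards_zeroState, if_pos]
  · rw [← ofReal_one_div_sqrt_two_pow, ← ofReal_one_div_sqrt_two_pow, ← pow_add]
    simp
  · rintro (j | v) <;> simp
  · refine List.Nodup.append ((List.nodup_finRange m).map Sum.inl_injective)
      ((Finset.nodup_toList _).map Sum.inr_injective) ?_
    intro w h1 h2
    simp only [List.mem_map] at h1 h2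
    obtain ⟨j, -, rfl⟩ := h1
    obtain ⟨v, -, h2⟩ := h2
    simp at h2

/-- The amplitudes of the measurement result `0`. -/
lemma run_phaseEstimationCircuit_zero (f : (V → Bool) → Bool) (s : V → Bool) :
    run f (phaseEstimationCircuit m V) (zeroState m V) (Sum.elim (fun _ => false) s) =
      ((1 / 2 ^ m * (1 / √(2 ^ Fintype.card V)) : ℝ) : ℂ) * planeVec f
        ((∏ j ∈ Finset.range m, (1 + (startPoint f ^ 2) ^ 2 ^ j)) * startPoint f) s := by
  have hM : ((1 / √(2 ^ m) : ℝ) : ℂ) * ((1 / √(2 ^ m) : ℝ) : ℂ) = ((1 / 2 ^ m : ℝ) : ℂ) := by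
    rw [← Complex.ofReal_mul, div_mul_div_comm, Real.mul_self_sqrt (by positivity), one_mul]
  have hstate : ∀ a : Fin m → Bool,
      (fun t : V → Bool => run f
        ((List.finRange m).map (fun j : Fin m => Gate.hadamard (Sum.inl j)) ++
        (Finset.univ : Finset V).toList.map (fun v => Gate.hadamard (Sum.inr v)))
        (zeroState m V) (Sum.elim a t)) = ((1 / √(2 ^ m) : ℝ) : ℂ) • uniformState V := by
    intro a
    funext t
    rw [run_hadamard_layers]
    rfl
  rw [phaseEstimationCircuit, run_append, run_append, run_inverseQFTCircuit]
  simp only [Matrix.mulVec, dotProduct, inverseQFT, Matrix.of_apply, ite_mul, zero_mul]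
  rw [sum_ite_second_eq, flatMap_cgrover_eq]
  simp only [run_cgrovers, Sum.elim_comp_inr, hstate, countP_flatMap_replicate]
  have h0 : readout (Sum.elim (fun _ => false) s : BasisState m V) = 0 := by simp [readout]
  -- At readout 0 all Fourier phases equal 1, which leaves the plain sum of the Grover powers.
  simp only [h0, Nat.cast_zero, mul_zero, neg_zero, zero_div, Complex.exp_zero, mul_one]
  rw [← sum_pow_bitsValue, Finset.sum_mul, planeVec_sum, Finset.mul_sum]
  refine Finset.sum_congr rfl fun a _ => ?_
  rw [uniformState_eq f, Matrix.mulVec_smul, Matrix.mulVec_smul, groverOperator_pow_planeVec,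
    Complex.ofReal_mul, ← hM]
  simp only [Pi.smul_apply, smul_eq_mul]
  ring

lemma measureProb_zero (ψ : BasisState m V → ℂ) :
    measureProb ψ 0 = ∑ s : V → Bool, ‖ψ (Sum.elim (fun _ => false) s)‖ ^ 2 := by
  have h : ∀ a s, readout (Sum.elim a s : BasisState m V) = 0 ↔ a = fun _ => false := by
    intro a s
    change bitsValue a = 0 ↔ _
    simp [bitsValue, funext_iff]
  rw [measureProb, ← (Equiv.sumArrowEquivProdArrow (Fin m) V Bool).symm.sum_comp,
    Fintype.sum_prod_type_right]
  refine Finset.sum_congr rfl fun s _ => ?_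
  simp only [Equiv.sumArrowEquivProdArrow, Equiv.coe_fn_symm_mk, h]
  simp

/-- Each |1 + w^(2^j)|² is 4 (1 - pⱼ), and the m factors 4 cancel the squared normalization 4^(-m)
of the two transforms of the first register. -/
lemma measureProb_phaseEstimation_zero_le (f : (V → Bool) → Bool) :
    measureProb (run f (phaseEstimationCircuit m V) (zeroState m V)) 0 ≤
      ∏ j ∈ Finset.range m, (1 - ‖(startPoint f ^ 2) ^ 2 ^ j - 1‖ ^ 2 / 4) := by
  rw [measureProb_zero]
  simp only [run_phaseEstimationCircuit_zero, norm_mul, mul_pow]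
  rw [← Finset.mul_sum]
  have h1 : ‖((1 / 2 ^ m * (1 / √(2 ^ Fintype.card V)) : ℝ) : ℂ)‖ ^ 2 =
      1 / 4 ^ m * (1 / 2 ^ Fintype.card V) := by
    rw [Complex.norm_real, Real.norm_eq_abs, sq_abs, mul_pow, div_pow, div_pow,
      Real.sq_sqrt (by positivity), ← pow_mul, mul_comm m, pow_mul]
    norm_num
  rw [h1]
  refine (mul_le_mul_of_nonneg_left (sum_norm_planeVec_le f _) (by positivity)).trans (le_of_eq ?_)
  rw [norm_mul, norm_startPoint, mul_one, norm_prod, ← Finset.prod_pow]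
  have h2 : ∀ j, ‖1 + (startPoint f ^ 2) ^ 2 ^ j‖ ^ 2 =
      4 * (1 - ‖(startPoint f ^ 2) ^ 2 ^ j - 1‖ ^ 2 / 4) := by
    intro j
    rw [norm_add_one_sq (by simp [norm_startPoint])]
    ring
  simp only [h2, Finset.prod_mul_distrib, Finset.prod_const, Finset.card_range]
  field_simp

lemma measureProb_phaseEstimation_zero_of_unmarked {f : (V → Bool) → Bool}
    (hf : ∀ s, f s = false) :
    measureProb (run f (phaseEstimationCircuit m V) (zeroState m V)) 0 = 1 := by
  have hq : markedFraction f = 0 := by simp [markedFraction, hf]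
  have hu : startPoint f = 1 := by simp [startPoint, hq, Complex.ext_iff]
  have hv : ∀ s, planeVec f
      ((∏ j ∈ Finset.range m, (1 + (startPoint f ^ 2) ^ 2 ^ j)) * startPoint f) s = 2 ^ m := by
    intro s
    have : (∏ j ∈ Finset.range m, (1 + (startPoint f ^ 2) ^ 2 ^ j)) * startPoint f =
        ((2 ^ m : ℝ) : ℂ) := by
      simp only [hu, one_pow, mul_one, Finset.prod_const, Finset.card_range]
      push_cast
      norm_num
    rw [this, planeVec, hq, hf, Complex.ofReal_re]
    simp
  rw [measureProb_zero]
  simp only [run_phaseEstimationCircuit_zero, hv]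
  have h : ((1 / 2 ^ m * (1 / √(2 ^ Fintype.card V)) : ℝ) : ℂ) * 2 ^ m =
      ((1 / √(2 ^ Fintype.card V) : ℝ) : ℂ) := by
    push_cast
    field_simp
  rw [h, Complex.norm_real, Real.norm_eq_abs, sq_abs, div_pow, Real.sq_sqrt (by positivity)]
  simp

end Circuit

/-! ### Gate counts and the size of 2^m -/

section Counting

variable {V : Type*} [Fintype V]

lemma sum_two_pow (m : ℕ) :
    ((List.finRange m).map fun j : Fin m => 2 ^ (j : ℕ)).sum = 2 ^ m - 1 := by
  rw [← Fin.sum_univ_def, ← Finset.sum_range fun j => 2 ^ j, Nat.geomSum_eq le_rfl]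
  simp

lemma groverCount_append {m : ℕ} {V : Type*} (C C' : List (Gate m V)) :
    groverCount (C ++ C') = groverCount C + groverCount C' :=
  List.countP_append

lemma groverCount_map_eq_zero {m : ℕ} {V ι : Type*} (g : ι → Gate m V)
    (hg : ∀ i, (g i).isCGrover = false) (L : List ι) : groverCount (L.map g) = 0 := by
  simp [groverCount, hg]

theorem groverCount_phaseEstimationCircuit (m : ℕ) (V : Type*) [Fintype V] :
    groverCount (phaseEstimationCircuit m V) = 2 ^ m - 1 := by
  have h1 : groverCount (inverseQFTCircuit m V) = 0 := by
    unfold inverseQFTCircuit groverCount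
    rw [List.countP_eq_zero]
    intro g hg
    simp only [List.mem_append, List.mem_map, List.mem_flatMap, List.mem_singleton] at hg
    rcases hg with ⟨i, -, rfl⟩ | ⟨i, -, ⟨l, -, rfl⟩ | rfl⟩ <;> simp [Gate.isCGrover]
  have h2 : groverCount ((List.finRange m).flatMap
      (fun j : Fin m => List.replicate (2 ^ (j : ℕ)) (Gate.cgrover j : Gate m V))) = 2 ^ m - 1 := by
    rw [groverCount, List.countP_flatMap, ← sum_two_pow]
    congr 1
    refine List.map_congr_left fun j _ => ?_
    simp [List.countP_replicate, Gate.isCGrover]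
  rw [phaseEstimationCircuit, groverCount_append, groverCount_append, groverCount_append,
    groverCount_map_eq_zero _ (fun _ => rfl), groverCount_map_eq_zero _ (fun _ => rfl), h1, h2]
  omega

lemma length_filter_lt {m : ℕ} (i : Fin m) :
    ((List.finRange m).filter fun l : Fin m => decide (l < i)).length = i := by
  rw [← List.toFinset_card_of_nodup ((List.nodup_finRange m).filter _), List.toFinset_filter,
    List.toFinset_finRange]
  have h : Finset.univ.filter (fun l : Fin m => decide (l < i) = true) = Finset.Iio i := by
    ext l
    simp
  rw [h, Fin.card_Iio]

/-- The swaps are crudely bounded by m; the stages have m(m+1)/2 gates. Doubling avoids division. -/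
lemma length_inverseQFTCircuit_le (m : ℕ) (V : Type*) :
    2 * (inverseQFTCircuit m V).length ≤ m * (m + 3) := by
  have h1 := List.length_filter_le (fun i : Fin m => decide (i < i.rev)) (List.finRange m)
  rw [List.length_finRange] at h1
  have h2 : ∑ i : Fin m, (i : ℕ) = ∑ i ∈ Finset.range m, i := (Finset.sum_range fun i => i).symm
  have h3 := Finset.sum_range_id_mul_two m
  have h4 : m * (m - 1) + m = m * m := by
    cases m with
    | zero => rfl
    | succ k => rw [Nat.add_sub_cancel]; ring
  simp only [inverseQFTCircuit, List.length_append, List.length_map, List.length_flatMap,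
    length_filter_lt, List.length_singleton]
  rw [← Fin.sum_univ_def, Finset.sum_add_distrib, h2]
  simp only [Finset.sum_const, Finset.card_univ, Fintype.card_fin, smul_eq_mul, mul_one]
  nlinarith

/-- The constants are those left over when 3m + (2^m - 1) + m(m+3)/2 ≤ 4·2^m is doubled and
rearranged. -/
lemma quadratic_le_two_pow (m : ℕ) : m * (m + 9) ≤ 6 * 2 ^ m + 2 := by
  have h : ∀ k : ℕ, (k + 3) * (k + 12) ≤ 6 * 2 ^ (k + 3) + 2 := by
    intro k
    induction k with
    | zero => norm_num
    | succ k ih =>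
      have hk : k + 3 < 2 ^ (k + 3) := Nat.lt_two_pow_self
      rw [show k + 1 + 3 = (k + 3) + 1 by ring, pow_succ]
      nlinarith
  match m with
  | 0 => norm_num
  | 1 => norm_num
  | 2 => norm_num
  | k + 3 => exact h k

theorem length_phaseEstimationCircuit_le {m : ℕ} (hm : Fintype.card V ≤ 2 * m) :
    (phaseEstimationCircuit m V).length ≤ 4 * 2 ^ m := by
  have h1 := length_inverseQFTCircuit_le m V
  have h2 := quadratic_le_two_pow m
  have h3 := Nat.one_le_two_pow (n := m)
  have h4 : (phaseEstimationCircuit m V).length =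
      m + Fintype.card V + (2 ^ m - 1) + (inverseQFTCircuit m V).length := by
    simp [phaseEstimationCircuit, List.length_flatMap, sum_two_pow, add_assoc]
  rw [h4]
  have h5 : m * (m + 9) = m * (m + 3) + 6 * m := by ring
  omega

lemma le_two_pow_digits (n c : ℕ) : 2 ^ c * √(2 ^ n) ≤ (2 : ℝ) ^ digits n c := by
  rw [digits, pow_add, mul_comm]
  gcongr
  rw [Real.sqrt_le_left (by positivity), ← pow_mul]
  exact pow_le_pow_right₀ (by norm_num) (by omega)

/-- The factor √2 pays for rounding n/2 up when n is odd. -/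
lemma two_pow_digits_le (n c : ℕ) : (2 : ℝ) ^ digits n c ≤ √2 * 2 ^ c * √(2 ^ n) := by
  have h : (2 : ℝ) ^ ((n + 1) / 2) ≤ √2 * √(2 ^ n) := by
    rw [← Real.sqrt_mul (by norm_num)]
    refine Real.le_sqrt_of_sq_le ?_
    rw [← pow_succ', ← pow_mul]
    exact pow_le_pow_right₀ (by norm_num) (by omega)
  rw [digits, pow_add]
  calc _ ≤ (√2 * √(2 ^ n)) * 2 ^ c := by gcongr
    _ = _ := by ring

end Counting

/-! ### Marked strings and violations of regularity -/

section Oracle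

lemma oracle_eq_false_of_isRegular {V : Type*} {G : SimpleGraph V} [DecidableRel G.Adj] {A B : Finset V}
    {ε : ℝ} (h : IsRegular G A B ε) (s : V → Bool) : oracle G A B ε s = false := by
  rw [oracle, decide_eq_false_iff_not, not_lt]
  exact h _ (Finset.filter_subset _ _) _ (Finset.filter_subset _ _)

/-- Since the parts are disjoint, the indicator of `X ∪ Y` encodes the violating pair: `A` recovers
`X` from it and `B` recovers `Y`. -/
lemma exists_oracle_eq_true {V : Type*} [DecidableEq V] {G : SimpleGraph V} [DecidableRel G.Adj] {A B : Finset V}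
    (hAB : Disjoint A B) {ε : ℝ} (h : ¬ IsRegular G A B ε) : ∃ s, oracle G A B ε s = true := by
  simp only [IsRegular, not_forall, not_le] at h
  obtain ⟨X, hX, Y, hY, h⟩ := h
  refine ⟨fun v => decide (v ∈ X ∪ Y), ?_⟩
  have h1 : selected A (fun v => decide (v ∈ X ∪ Y)) = X := by
    ext v
    simp only [selected, Finset.mem_filter, decide_eq_true_eq, Finset.mem_union]
    exact ⟨fun ⟨hv, hv'⟩ => hv'.resolve_right fun hY' => Finset.disjoint_left.1 hAB hv (hY hY'),
      fun hv => ⟨hX hv, Or.inl hv⟩⟩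
  have h2 : selected B (fun v => decide (v ∈ X ∪ Y)) = Y := by
    ext v
    simp only [selected, Finset.mem_filter, decide_eq_true_eq, Finset.mem_union]
    exact ⟨fun ⟨hv, hv'⟩ => hv'.resolve_left fun hX' => Finset.disjoint_left.1 hAB (hX hX') hv,
      fun hv => ⟨hY hv, Or.inr hv⟩⟩
  rw [oracle, decide_eq_true_eq, h1, h2]
  exact h

/-- Excludes the empty graph from the irregular case, where m = 0 is possible and the bound 3/4
would fail. -/
lemma isRegular_of_isEmpty {V : Type*} [IsEmpty V] (G : SimpleGraph V) [DecidableRel G.Adj] (A B : Finset V)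
    (ε : ℝ) : IsRegular G A B ε := by
  intro X _ Y _
  simp [deviation, Finset.eq_empty_of_isEmpty]

end Oracle

/-! ### The error bound -/

section Correctness

variable {V : Type*} [Fintype V] [DecidableEq V]

lemma measureProb_phaseEstimation_zero_of_marked {f : (V → Bool) → Bool} {s : V → Bool}
    (hs : f s = true) (hV : 0 < Fintype.card V) (c : ℕ) :
    measureProb (run f (phaseEstimationCircuit (digits (Fintype.card V) c) V)
      (zeroState (digits (Fintype.card V) c) V)) 0 ≤ min (3 / 4) ((1 / 4) ^ c) := by
  set m := digits (Fintype.card V) c with hm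
  -- With w = e^(2iθ) this is sin²(2^j θ), and `hp` is the double-angle formula.
  set p : ℕ → ℝ := fun j => ‖(startPoint f ^ 2) ^ 2 ^ j - 1‖ ^ 2 / 4 with hp_def
  have hnorm : ∀ j : ℕ, ‖(startPoint f ^ 2) ^ 2 ^ j‖ = 1 := fun j => by simp [norm_startPoint]
  have hp : ∀ j, p (j + 1) = 4 * p j * (1 - p j) := by
    intro j
    have h : (startPoint f ^ 2) ^ 2 ^ (j + 1) - 1 =
        ((startPoint f ^ 2) ^ 2 ^ j - 1) * (1 + (startPoint f ^ 2) ^ 2 ^ j) := by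
      rw [pow_succ 2 j, pow_mul]
      ring
    simp only [hp_def]
    rw [h, norm_mul, mul_pow, norm_add_one_sq (hnorm j)]
    ring
  have h0 : ∀ j, 0 ≤ p j := fun j => by positivity
  have h1 : ∀ j, p j ≤ 1 := by
    intro j
    have := norm_add_one_sq (hnorm j)
    have := sq_nonneg ‖1 + (startPoint f ^ 2) ^ 2 ^ j‖
    simp only [hp_def]
    linarith
  have hp0 : p 0 = markedFraction f := by
    simp only [hp_def, pow_zero, pow_one, norm_startPoint_sq_sub_one]
    ring
  have hc : 4 ^ c ≤ 4 ^ m * p 0 := by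
    rw [hp0]
    refine le_trans ?_ (mul_le_mul_of_nonneg_left (inv_le_markedFraction hs) (by positivity))
    rw [mul_one_div, le_div_iff₀ (by positivity), show (4 : ℝ) = 2 ^ 2 by norm_num, ← pow_mul,
      ← pow_mul, ← pow_add]
    refine pow_le_pow_right₀ (by norm_num) ?_
    -- What remains is 2c + n ≤ 2(⌈n/2⌉ + c), which fixes the choice of the number of digits.
    rw [hm, digits]
    omega
  refine (measureProb_phaseEstimation_zero_le f).trans (le_min ?_ ?_)
  · refine logistic_prod_le_three_quarters hp h0 h1 ?_
      ((one_le_pow₀ (by norm_num : (1 : ℝ) ≤ 4)).trans hc)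
    rw [hm, digits]
    omega
  · exact logistic_prod_le_inv hp h1 hc

end Correctness

end RegularityCheck

end

theorem mainTheorem5 {V : Type*} [Fintype V] [DecidableEq V]
    (G : SimpleGraph V) [DecidableRel G.Adj] (A B : Finset V)
    (hG : G.IsBipartiteWith (A : Set V) (B : Set V)) (hAB : ∀ v, v ∈ A ∨ v ∈ B)
    (n₁ n₂ : ℕ) (hA : A.card = n₁) (hB : B.card = n₂) (ε : ℝ) (c : ℕ) :
    let m : ℕ := RegularityCheck.digits (n₁ + n₂) c
    let C : List (RegularityCheck.Gate m V) := RegularityCheck.phaseEstimationCircuit m V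
    -- the last part of the circuit is the inverse quantum Fourier transform
    (∀ (f : (V → Bool) → Bool) (ψ : RegularityCheck.BasisState m V → ℂ),
      RegularityCheck.run f (RegularityCheck.inverseQFTCircuit m V) ψ =
        (RegularityCheck.inverseQFT m V).mulVec ψ) ∧
    -- the number of controlled Grover gates
    RegularityCheck.groverCount C = 2 ^ m - 1 ∧
    2 ^ c * √(2 ^ (n₁ + n₂)) - 1 ≤ (RegularityCheck.groverCount C : ℝ) ∧
    (RegularityCheck.groverCount C : ℝ) ≤ √2 * 2 ^ c * √(2 ^ (n₁ + n₂)) ∧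
    -- the number of all gates
    (C.length : ℝ) ≤ 6 * 2 ^ c * √(2 ^ (n₁ + n₂)) ∧
    -- correctness of the answer
    (RegularityCheck.IsRegular G A B ε →
      RegularityCheck.probAnswerRegular G A B ε m = 1) ∧
    (¬ RegularityCheck.IsRegular G A B ε →
      RegularityCheck.probAnswerRegular G A B ε m ≤ min (3 / 4) ((1 / 4) ^ c)) := by
  intro m C
  have hdisj : Disjoint A B := Finset.disjoint_coe.1 hG.disjoint
  have hcard : Fintype.card V = n₁ + n₂ := by
    rw [← hA, ← hB, ← Finset.card_union_of_disjoint hdisj, ← Finset.card_univ]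
    congr 1
    ext v
    simpa using hAB v
  have hcount : RegularityCheck.groverCount C = 2 ^ m - 1 :=
    RegularityCheck.groverCount_phaseEstimationCircuit m V
  have hcount' : (RegularityCheck.groverCount C : ℝ) = 2 ^ m - 1 := by
    rw [hcount, Nat.cast_sub Nat.one_le_two_pow]
    push_cast
    rfl
  have hlow := RegularityCheck.le_two_pow_digits (n₁ + n₂) c
  have hup := RegularityCheck.two_pow_digits_le (n₁ + n₂) c
  refine ⟨fun f ψ => RegularityCheck.run_inverseQFTCircuit f ψ, hcount, ?_, ?_, ?_, ?_, ?_⟩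
  · rw [hcount']
    exact sub_le_sub_right hlow 1
  · rw [hcount']
    linarith
  · have hm : Fintype.card V ≤ 2 * m := by
      rw [hcard]
      simp only [m, RegularityCheck.digits]
      omega
    have hlen : (C.length : ℝ) ≤ 4 * 2 ^ m := by
      exact_mod_cast RegularityCheck.length_phaseEstimationCircuit_le hm
    -- The constant 6 is 4 gates per unit of 2^m times the rounding factor √2, rounded up.
    have hsqrt : 4 * √2 ≤ 6 := by
      have : √2 ≤ 3 / 2 := Real.sqrt_le_iff.2 (by norm_num)
      linarith
    calc (C.length : ℝ) ≤ 4 * 2 ^ m := hlen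
      _ ≤ 4 * (√2 * 2 ^ c * √(2 ^ (n₁ + n₂))) := by gcongr
      _ = 4 * √2 * (2 ^ c * √(2 ^ (n₁ + n₂))) := by ring
      _ ≤ 6 * (2 ^ c * √(2 ^ (n₁ + n₂))) := by gcongr
      _ = 6 * 2 ^ c * √(2 ^ (n₁ + n₂)) := by ring
  · intro h
    exact RegularityCheck.measureProb_phaseEstimation_zero_of_unmarked
      (RegularityCheck.oracle_eq_false_of_isRegular h)
  · intro h
    obtain ⟨s, hs⟩ := RegularityCheck.exists_oracle_eq_true hdisj h
    have hV : 0 < Fintype.card V := by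
      rw [Fintype.card_pos_iff]
      by_contra hV
      rw [not_nonempty_iff] at hV
      exact h (RegularityCheck.isRegular_of_isEmpty G A B ε)
    have := RegularityCheck.measureProb_phaseEstimation_zero_of_marked hs hV c
    rw [hcard] at this
    exact this
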